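/- **Setting.** Let $\mathcal Z=\mathcal X\times\mathcal Y$ carry a $\sigma$-algebra, let $\nu$ be a probability law on $\mathcal Z$, and let $Z_1,Z_2,\dots$ be i.i.d. random elements of $\mathcal Z$ with law $\nu$, defined on a probability space $(\Omega,\mathcal S,\mathbb P)$; put $S_n=(Z_1,\dots,Z_n)$. Let $\ell:\mathcal Y\times\mathcal Y\to[0,\infty)$ be a loss function, $\mathcal H$ a set of functions $\psi:\mathcal X\to\mathcal Y$, and write $\ell(z,\psi)=\ell(y,\psi(x))$ for $z=(x,y)$. Assume that $z\mapsto\ell(z,\psi)$ is measurable for every $\psi\in\mathcal H$, put $L(\psi)=\int\ell(z,\psi)\,d\nu(z)$ and $C_\ell=\sup_{z\in\mathcal Z,\,\psi\in\mathcal H}\ell(z,\psi)$, and let $$\mathcal A^\star_{\mathcal H,\ell}=\bigl\{\{z\in\mathcal Z:\ell(z,\psi)>b\}:\ \psi\in\mathcal H,\ b\in(0,C_\ell)\bigr\}.$$ The VC dimension $d_{VC}(\mathcal H,\ell)$ is the VC dimension of the class of sets $\mathcal A^\star_{\mathcal H,\ell}$, that is, the greatest integer $n$ with $\sup_{z_1,\dots,z_n}\bigl|\{(\mathbf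 1\{z_1\in A\},\dots,\mathbf 1\{z_n\in A\}):A\in\mathcal A^\star_{\mathcal H,\ell}\}\bigr|=2^n$ ($\infty$ if there are arbitrarily large such $n$). A prediction rule is a family of maps $\Psi_n:\mathcal Z^n\to\mathcal H$, $n\ge1$, such that $(s,z)\mapsto\ell(z,\Psi_n(s))$ is jointly measurable on $\mathcal Z^n\times\mathcal Z$ for every $n$; put $\psi_n=\Psi_n(S_n)$. For every $n$ and every sample $s\in\mathcal Z^n$ let $\mathscr B(s)=\{\beta_{z,\psi,s}:z\in\mathcal Z,\psi\in\mathcal H\}$ be a collection of probability measures on $\mathcal Z$. The $\mathscr B$-generalized resubstitution error is $$\hat\varepsilon_n^{\mathscr B}=\frac1n\sum_{i=1}^n\int_{\mathcal Z}\ell(z',\psi_n)\,d\beta_{Z_i,\psi_n,S_n}(z'),$$ and it is called consistent if $|\hat\varepsilon_n^{\mathscr B}-L(\psi_n)|\to0$ with probability one as $n\to\infty$. **Corollary.** Suppose that $C_\ell<\infty$ (the loss is bounded) and $d_{VC}(\mathcal H,\ell)<\infty$. If $$\sup_{A\in\mathcal A^\star_{\mathcal H,\ell}}\Bigl|\frac1n\sum_{i=1}^n\beta_{Z_i,\psi_n,S_n}(A)-\frac1n\sum_{i=1}^n\delta_{Z_i}(A)\Bigr|\to0$$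 with probability one as $n\to\infty$, then $\hat\varepsilon_n^{\mathscr B}$ is consistent. In particular, if $$\sup_{A\in\mathcal A^\star_{\mathcal H,\ell},\ z\in\mathcal Z,\ \psi\in\mathcal H}\bigl|\beta_{z,\psi,S_n}(A)-\delta_z(A)\bigr|\to0$$ with probability one as $n\to\infty$, then $\hat\varepsilon_n^{\mathscr B}$ is consistent. -/

import Mathlib

open MeasureTheory ProbabilityTheory Filter Topology
open scoped NNReal ENNReal

noncomputable section

namespace GenResub

/-- The `n`-th shatter coefficient of a class `𝒜` of subsets of `Z`: the supremum over
`z₁, …, zₙ` of the number of distinct membership patterns `(1{z₁ ∈ A}, …, 1{zₙ ∈ A})`, `A ∈ 𝒜`. -/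
def shatterCoeff {Z : Type*} (𝒜 : Set (Set Z)) (n : ℕ) : ℕ∞ :=
  ⨆ z : Fin n → Z, Set.encard {v : Fin n → Prop | ∃ A ∈ 𝒜, v = fun i => z i ∈ A}

/-- The VC dimension of a class of sets: the largest `n` with shatter coefficient `2 ^ n`
(`⊤` if there are arbitrarily large such `n`). -/
def vcDim {Z : Type*} (𝒜 : Set (Set Z)) : ℕ∞ :=
  ⨆ (n : ℕ) (_ : shatterCoeff 𝒜 n = 2 ^ n), (n : ℕ∞)

section

variable {X Y : Type*}

/-- The loss `ℓ(z, ψ) = ℓ(y, ψ(x))` of the hypothesis `ψ` at the point `z = (x, y)`. -/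
def lossAt (ℓ : Y → Y → ℝ≥0) (ψ : X → Y) (z : X × Y) : ℝ≥0 := ℓ z.2 (ψ z.1)

/-- The supremum `C_ℓ` of the loss over all points and all hypotheses. -/
def lossSup (ℓ : Y → Y → ℝ≥0) (H : Set (X → Y)) : ℝ≥0∞ :=
  ⨆ (z : X × Y) (ψ : H), (lossAt ℓ ψ z : ℝ≥0∞)

/-- The class of superlevel sets `{z | ℓ(z, ψ) > b}`, `ψ ∈ H`, `0 < b < C_ℓ`. -/
def superlevelSets (ℓ : Y → Y → ℝ≥0) (H : Set (X → Y)) : Set (Set (X × Y)) :=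
  {A | ∃ ψ ∈ H, ∃ b : ℝ≥0, 0 < b ∧ (b : ℝ≥0∞) < lossSup ℓ H ∧ A = {z | b < lossAt ℓ ψ z}}

/-- The VC dimension of the hypothesis space `H` under the loss `ℓ`. -/
def lossVCDim (ℓ : Y → Y → ℝ≥0) (H : Set (X → Y)) : ℕ∞ := vcDim (superlevelSets ℓ H)

/-- A prediction rule: it maps each sample of each size to a hypothesis in `H`. -/
abbrev PredictionRule (H : Set (X → Y)) : Type _ := (n : ℕ) → (Fin n → X × Y) → H

/-- The sample `Sₙ` formed by the first `n` terms of a sequence of data points. -/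
def sample {Ω : Type*} (Z : ℕ → Ω → X × Y) (n : ℕ) (ω : Ω) : Fin n → X × Y := fun i => Z i ω

/- The σ-algebra of the data space `X × Y`; it need not be a product σ-algebra. -/
variable [MeasurableSpace (X × Y)]

/-- A collection of smoothing measures `β_{z, ψ, Sₙ}` for each sample `Sₙ` of each size. -/
abbrev Smoothing (H : Set (X → Y)) : Type _ :=
  (n : ℕ) → (Fin n → X × Y) → X × Y → H → Measure (X × Y)

/-- The expected loss `L(ψ)` of `ψ` under the law `ν`. -/
def risk (ℓ : Y → Y → ℝ≥0) (ν : Measure (X × Y)) (ψ : X → Y) : ℝ :=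
  ∫ z, (lossAt ℓ ψ z : ℝ) ∂ν

/-- The smoothed loss `ℓ_ℬ(z, ψ) = ∫ ℓ(z', ψ) dβ_{z, ψ, Sₙ}(z')`, given the sample `s`. -/
def smoothedLoss (ℓ : Y → Y → ℝ≥0) {H : Set (X → Y)} (β : Smoothing H) {n : ℕ}
    (s : Fin n → X × Y) (z : X × Y) (ψ : H) : ℝ :=
  ∫ z', (lossAt ℓ ψ z' : ℝ) ∂(β n s z ψ)

/-- The generalized resubstitution error of `ψₙ = Ψₙ(Sₙ)`, given the sample `s`. -/
def genResubError (ℓ : Y → Y → ℝ≥0) {H : Set (X → Y)} (Ψ : PredictionRule H) (β : Smoothing H)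
    {n : ℕ} (s : Fin n → X × Y) : ℝ :=
  (1 / (n : ℝ)) * ∑ i, smoothedLoss ℓ β s (s i) (Ψ n s)

/-- The generalized resubstitution error is consistent: its distance to the prediction error
`εₙ = L(ψₙ)` tends to zero with probability one. -/
def IsConsistent {Ω : Type*} [MeasurableSpace Ω] (P : Measure Ω) (Z : ℕ → Ω → X × Y)
    (ν : Measure (X × Y)) (ℓ : Y → Y → ℝ≥0) {H : Set (X → Y)} (Ψ : PredictionRule H)
    (β : Smoothing H) : Prop :=
  ∀ᵐ ω ∂P, Tendsto
    (fun n => |genResubError ℓ Ψ β (sample Z n ω) - risk ℓ ν (Ψ n (sample Z n ω))|) atTop (𝓝 0)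

/-- The supremum over the superlevel sets `A` of
`|(1/n) ∑ᵢ β_{zᵢ, ψₙ, Sₙ}(A) - (1/n) ∑ᵢ δ_{zᵢ}(A)|`, given the sample `s = (z₁, …, zₙ)`. -/
def empiricalGap (ℓ : Y → Y → ℝ≥0) {H : Set (X → Y)} (Ψ : PredictionRule H) (β : Smoothing H)
    {n : ℕ} (s : Fin n → X × Y) : ℝ≥0∞ :=
  ⨆ A ∈ superlevelSets ℓ H, ENNReal.ofReal
    |(1 / (n : ℝ)) * ∑ i, (β n s (s i) (Ψ n s)).real A
      - (1 / (n : ℝ)) * ∑ i, (Measure.dirac (s i)).real A|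

/-- The supremum over the superlevel sets `A`, the points `z` and the hypotheses `ψ` of
`|β_{z, ψ, Sₙ}(A) - δ_z(A)|`, given the sample `s`. -/
def uniformGap (ℓ : Y → Y → ℝ≥0) {H : Set (X → Y)} (β : Smoothing H) {n : ℕ}
    (s : Fin n → X × Y) : ℝ≥0∞ :=
  ⨆ A ∈ superlevelSets ℓ H, ⨆ (z : X × Y) (ψ : H), ENNReal.ofReal
    |(β n s z ψ).real A - (Measure.dirac z).real A|

end

end GenResub

end

namespace GenResub

/-! The layer-cake formula writes the integral of a bounded loss as an integral of superlevel-set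
probabilities over the levels in (0, C_ℓ). Replacing point masses by smoothing measures therefore
changes the empirical risk by at most C_ℓ times the gap (`abs_genResubError_sub_le`), and the
uniform gap dominates the empirical one.

It remains to show that the plain empirical risk of ψₙ tracks L(ψₙ) (`ae_tendsto_selected`). This is
a Vapnik–Chervonenkis argument run on the selected hypothesis alone, so that no supremum over `H`
has to be measurable. A ghost sample replaces the risk by a second empirical mean
(`measure_pi_selected_ge_le`). Random exchanges between the two samples turn the difference into a
signed sum (`measure_pi_pairs_le`). Sauer–Shelah leaves polynomially many traces, Hoeffding makes
each exponentially unlikely to deviate, and Borel–Cantelli concludes. -/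

/-! ### Layer-cake comparison of integrals -/

theorem antitone_measureReal_superlevel {S : Type*} [MeasurableSpace S] (μ : Measure S)
    [IsFiniteMeasure μ] (f : S → ℝ) : Antitone fun t : ℝ => μ.real {z | t < f z} :=
  fun _ _ hab => measureReal_mono fun _ hz => lt_of_le_of_lt hab hz

/-- Layer cake, cut at `C` because higher superlevel sets are empty. The open interval matches the
levels admitted in `superlevelSets`. -/
theorem integral_eq_setIntegral_superlevel {S : Type*} [MeasurableSpace S] (μ : Measure S)
    [IsFiniteMeasure μ] {f : S → ℝ≥0} (hf : Measurable f) {C : ℝ≥0} (hC : ∀ z, f z ≤ C) :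
    ∫ z, (f z : ℝ) ∂μ = ∫ t in Set.Ioo (0 : ℝ) C, μ.real {z | t < f z} := by
  have hint : Integrable (fun z => (f z : ℝ)) μ :=
    Integrable.of_mem_Icc 0 C (by fun_prop) (ae_of_all _ fun z => ⟨by simp, by simpa using hC z⟩)
  rw [hint.integral_eq_integral_meas_lt (ae_of_all _ fun z => by simp)]
  refine setIntegral_eq_of_subset_of_forall_sdiff_eq_zero measurableSet_Ioi
    (fun t ht => ht.1) fun t ht => ?_
  have : {z | t < (f z : ℝ)} = ∅ := by
    ext z
    simp only [Set.mem_ofPred_eq, Set.mem_empty_iff_false, iff_false, not_lt]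
    have h1 : (C : ℝ) ≤ t := by
      by_contra h
      exact ht.2 ⟨ht.1, not_le.1 h⟩
    exact le_trans (by exact_mod_cast hC z) h1
  simp [this]

/-- The integrals of a bounded function against two measures differ by at most the bound times
the largest discrepancy on the superlevel sets. -/
theorem abs_integral_sub_le_of_superlevel {S : Type*} [MeasurableSpace S] (μ₁ μ₂ : Measure S)
    [IsFiniteMeasure μ₁] [IsFiniteMeasure μ₂] {f : S → ℝ≥0} (hf : Measurable f) {C : ℝ≥0}
    (hC : ∀ z, f z ≤ C) {g : ℝ}
    (h : ∀ b : ℝ≥0, 0 < b → b < C → |μ₁.real {z | b < f z} - μ₂.real {z | b < f z}| ≤ g) :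
    |∫ z, (f z : ℝ) ∂μ₁ - ∫ z, (f z : ℝ) ∂μ₂| ≤ C * g := by
  have hint : ∀ (μ : Measure S) [IsFiniteMeasure μ],
      IntegrableOn (fun t : ℝ => μ.real {z | t < f z}) (Set.Ioo (0 : ℝ) C) := fun μ _ =>
    Integrable.of_mem_Icc 0 (μ.real Set.univ)
      (antitone_measureReal_superlevel μ _).measurable.aemeasurable
      (ae_of_all _ fun t => ⟨measureReal_nonneg, measureReal_mono (Set.subset_univ _)⟩)
  rw [integral_eq_setIntegral_superlevel μ₁ hf hC, integral_eq_setIntegral_superlevel μ₂ hf hC,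
    ← integral_sub (hint μ₁) (hint μ₂)]
  have := norm_setIntegral_le_of_norm_le_const (μ := volume) (s := Set.Ioo (0 : ℝ) C) (C := g)
    (f := fun t : ℝ => μ₁.real {z | t < f z} - μ₂.real {z | t < f z}) (by simp)
    (fun t ht => by
      lift t to ℝ≥0 using ht.1.le
      simpa only [NNReal.coe_lt_coe, Real.norm_eq_abs] using
        h t (by exact_mod_cast ht.1) (by exact_mod_cast ht.2))
  simpa [mul_comm] using this

/-! ### Shatter coefficients and Sauer–Shelah -/

theorem shatterCoeff_eq_two_pow {S : Type*} {𝒜 : Set (Set S)} {n : ℕ} (z : Fin n → S)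
    (h : ∀ v : Fin n → Prop, ∃ A ∈ 𝒜, ∀ i, v i ↔ z i ∈ A) : shatterCoeff 𝒜 n = 2 ^ n := by
  have hcard : (Set.univ : Set (Fin n → Prop)).encard = 2 ^ n := by
    rw [Set.encard_univ, ENat.card_eq_coe_fintype_card]
    simp
  apply le_antisymm
  · exact iSup_le fun z => hcard ▸ Set.encard_le_encard (Set.subset_univ _)
  · refine le_iSup_of_le z (hcard ▸ Set.encard_le_encard fun v _ => ?_)
    obtain ⟨A, hA, hv⟩ := h v
    exact ⟨A, hA, funext fun i => propext (hv i)⟩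

/-- Termwise comparison with the binomial expansion of the right-hand side. -/
theorem sum_choose_le_pow (N d : ℕ) : ∑ k ∈ Finset.Iic d, N.choose k ≤ (N + 1) ^ d := by
  rw [add_pow, show Finset.Iic d = Finset.range (d + 1) by ext; simp]
  refine Finset.sum_le_sum fun k hk => ?_
  have : 0 < d.choose k := Nat.choose_pos (Nat.lt_succ_iff.1 (Finset.mem_range.1 hk))
  calc N.choose k ≤ N ^ k := Nat.choose_le_pow _ _
    _ ≤ N ^ k * 1 ^ (d - k) * d.choose k := by
      rw [one_pow, mul_one]; exact Nat.le_mul_of_pos_right _ this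

/-- Sauer-Shelah: a class of VC dimension at most `d` cuts out polynomially many subsets of a
finite family of points. -/
theorem exists_finset_traces {S : Type*} {𝒜 : Set (Set S)} {d : ℕ} (hd : vcDim 𝒜 ≤ d)
    {ι : Type*} [Fintype ι] (p : ι → S) :
    ∃ T : Finset (Finset ι), T.card ≤ (Fintype.card ι + 1) ^ d ∧
      ∀ A ∈ 𝒜, ∃ t ∈ T, ∀ i, i ∈ t ↔ p i ∈ A := by
  classical
  let T : Finset (Finset ι) :=
    Finset.univ.filter fun t => ∃ A ∈ 𝒜, ∀ i, i ∈ t ↔ p i ∈ A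
  refine ⟨T, ?_, fun A hA => ⟨Finset.univ.filter fun i => p i ∈ A, ?_, by simp⟩⟩
  · have hT : T.vcDim ≤ d := by
      refine Finset.sup_le fun s hs => ?_
      have hs := Finset.mem_shatterer.1 hs
      have key : shatterCoeff 𝒜 s.card = 2 ^ s.card := by
        refine shatterCoeff_eq_two_pow (fun i => p (s.equivFin.symm i)) fun v => ?_
        obtain ⟨u, hu, hsu⟩ := hs (t := s.filter fun x => ∃ h : x ∈ s, v (s.equivFin ⟨x, h⟩))
          (Finset.filter_subset _ _)
        obtain ⟨A, hA, hAu⟩ := (Finset.mem_filter.1 hu).2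
        refine ⟨A, hA, fun i => ?_⟩
        have := Finset.ext_iff.1 hsu (s.equivFin.symm i)
        simp only [Finset.mem_inter, Finset.coe_mem, true_and, Finset.mem_filter, Subtype.coe_eta,
          Equiv.apply_symm_apply, exists_const] at this
        rw [← hAu, this]
      have : (s.card : ℕ∞) ≤ vcDim 𝒜 := le_iSup₂_of_le s.card key le_rfl
      exact_mod_cast this.trans hd
    calc T.card ≤ T.shatterer.card := T.card_le_card_shatterer
      _ ≤ ∑ k ∈ Finset.Iic T.vcDim, (Fintype.card ι).choose k := Finset.card_shatterer_le_sum_vcDim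
      _ ≤ ∑ k ∈ Finset.Iic d, (Fintype.card ι).choose k :=
        Finset.sum_le_sum_of_subset (Finset.Iic_subset_Iic.2 hT)
      _ ≤ _ := sum_choose_le_pow _ _
  · exact Finset.mem_filter.2 ⟨Finset.mem_univ _, A, hA, by simp⟩

/-! ### Hoeffding bounds and random signs -/

/-- Two-sided Hoeffding inequality for the mean of centred variables bounded by `B`. -/
theorem measureReal_abs_sum_ge_le {Ω : Type*} [MeasurableSpace Ω] (μ : Measure Ω)
    [IsProbabilityMeasure μ] {n : ℕ} (hn : 0 < n) {X : Fin n → Ω → ℝ} (hX : iIndepFun X μ)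
    (hm : ∀ i, Measurable (X i)) {B : ℝ} (hB : 0 < B) (hXB : ∀ i ω, |X i ω| ≤ B)
    (h0 : ∀ i, ∫ ω, X i ω ∂μ = 0) {η : ℝ} (hη : 0 ≤ η) :
    μ.real {ω | n * η ≤ |∑ i, X i ω|} ≤ 2 * Real.exp (-(n * (η ^ 2 / (2 * B ^ 2)))) := by
  have hsub : ∀ i, HasSubgaussianMGF (X i) ((‖B - -B‖₊ / 2) ^ 2) μ := fun i =>
    hasSubgaussianMGF_of_mem_Icc_of_integral_eq_zero (hm i).aemeasurable
      (ae_of_all _ fun ω => abs_le.1 (hXB i ω)) (h0 i)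
  -- Variance proxy given by Hoeffding's lemma on [-B, B]: half the length, squared.
  have hc : (((‖B - -B‖₊ / 2) ^ 2 : ℝ≥0) : ℝ) = B ^ 2 := by
    simp only [NNReal.coe_pow, NNReal.coe_div, coe_nnnorm, Real.norm_eq_abs]
    rw [abs_of_pos (by linarith)]
    norm_num
  have hn' : (0 : ℝ) < n := by exact_mod_cast hn
  have hexp : ∀ Y : Fin n → Ω → ℝ, iIndepFun Y μ →
      (∀ i, HasSubgaussianMGF (Y i) ((‖B - -B‖₊ / 2) ^ 2) μ) →
      μ.real {ω | n * η ≤ ∑ i, Y i ω} ≤ Real.exp (-(n * (η ^ 2 / (2 * B ^ 2)))) := by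
    intro Y hY hs
    have := HasSubgaussianMGF.measure_sum_ge_le_of_iIndepFun hY (s := Finset.univ)
      (fun i _ => hs i) (ε := n * η) (by positivity)
    refine this.trans (le_of_eq ?_)
    congr 1
    simp only [Finset.sum_const, Finset.card_univ, Fintype.card_fin, nsmul_eq_mul,
      NNReal.coe_mul, NNReal.coe_natCast, hc]
    field_simp
  have h1 := hexp X hX hsub
  have h2 := hexp (fun i => -X i) (hX.comp (fun _ x => -x) fun _ => measurable_neg)
    fun i => (hsub i).neg
  have hsubset : {ω | n * η ≤ |∑ i, X i ω|} ⊆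
      {ω | n * η ≤ ∑ i, X i ω} ∪ {ω | n * η ≤ ∑ i, (-X i) ω} := by
    intro ω hω
    simpa [le_abs] using hω
  calc _ ≤ _ := measureReal_mono hsubset
    _ ≤ _ := measureReal_union_le _ _
    _ ≤ _ := by linarith

/-- The law of a fair coin. -/
noncomputable def coin : Measure Bool := (2⁻¹ : ℝ≥0∞) • (Measure.dirac true + Measure.dirac false)

instance : IsProbabilityMeasure coin := ⟨by simp [coin, ENNReal.inv_two_add_inv_two]⟩

/-- The sign `±1` attached to the outcome of a coin. -/
def sgn (b : Bool) : ℝ := if b then 1 else -1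

theorem measure_coin_abs_sum_ge_le {n : ℕ} (hn : 0 < n) (a : Fin n → ℝ) (ha : ∀ i, |a i| ≤ 1)
    {η : ℝ} (hη : 0 ≤ η) :
    Measure.pi (fun _ : Fin n => coin) {σ | n * η ≤ |∑ i, sgn (σ i) * a i|} ≤
      ENNReal.ofReal (2 * Real.exp (-(n * (η ^ 2 / 2)))) := by
  have hc : ∀ i, ∫ σ, sgn (σ i) * a i ∂(Measure.pi fun _ : Fin n => coin) = 0 := fun i => by
    rw [integral_mul_const]
    have : ∫ b, sgn b ∂coin = 0 := by
      rw [coin, integral_smul_measure, integral_add_measure (by simp) (by simp)]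
      simp [sgn]
    rw [integral_comp_eval (μ := fun _ : Fin n => coin) (f := sgn)
      (measurable_of_finite _).aestronglyMeasurable, this, zero_mul]
  have := measureReal_abs_sum_ge_le (Measure.pi fun _ : Fin n => coin) hn
    (X := fun i σ => sgn (σ i) * a i)
    (iIndepFun_pi (X := fun i b => sgn b * a i) fun i => (measurable_of_finite _).aemeasurable)
    (fun i => (measurable_of_finite _)) one_pos
    (fun i σ => by
      rw [abs_mul]
      have : |sgn (σ i)| = 1 := by cases h : σ i <;> simp [sgn]
      rw [this, one_mul]; exact ha i) hc hη
  rw [one_pow, mul_one] at this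
  exact (ENNReal.le_ofReal_iff_toReal_le (measure_ne_top _ _) (by positivity)).2 this

/-- Union bound over the traces of a class of finite VC dimension. -/
theorem measure_coin_exists_abs_sum_ge_le {S : Type*} {𝒜 : Set (Set S)} {d : ℕ}
    (hd : vcDim 𝒜 ≤ d) {n : ℕ} (hn : 0 < n) (w : Fin n → S × S) {η : ℝ} (hη : 0 ≤ η) :
    Measure.pi (fun _ : Fin n => coin) {σ | ∃ A ∈ 𝒜, n * η ≤
      |∑ i, sgn (σ i) * (A.indicator 1 (w i).1 - A.indicator 1 (w i).2)|} ≤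
      ENNReal.ofReal ((2 * n + 1) ^ d * (2 * Real.exp (-(n * (η ^ 2 / 2))))) := by
  classical
  -- Traces are taken on all 2n points of the pairs, whence the factor `(2 * n + 1) ^ d`.
  obtain ⟨T, hT, hTA⟩ := exists_finset_traces hd (ι := Fin n × Bool)
    fun j => if j.2 then (w j.1).1 else (w j.1).2
  let a (t : Finset (Fin n × Bool)) (i : Fin n) : ℝ :=
    (if (i, true) ∈ t then 1 else 0) - (if (i, false) ∈ t then 1 else 0)
  have hsubset : {σ : Fin n → Bool | ∃ A ∈ 𝒜, n * η ≤
      |∑ i, sgn (σ i) * (A.indicator 1 (w i).1 - A.indicator 1 (w i).2)|} ⊆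
      ⋃ t ∈ T, {σ | n * η ≤ |∑ i, sgn (σ i) * a t i|} := by
    rintro σ ⟨A, hA, hσ⟩
    obtain ⟨t, ht, hAt⟩ := hTA A hA
    simp only [Set.mem_iUnion]
    refine ⟨t, ht, hσ.trans (le_of_eq ?_)⟩
    congr 1
    refine Finset.sum_congr rfl fun i _ => ?_
    simp [a, hAt, Set.indicator_apply]
  refine (measure_mono hsubset).trans <| (measure_biUnion_finset_le _ _).trans ?_
  refine (Finset.sum_le_sum fun t _ => measure_coin_abs_sum_ge_le hn (a t) (fun i => ?_) hη).trans
    ?_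
  · simp only [a]
    split_ifs <;> simp
  · rw [Finset.sum_const, nsmul_eq_mul, ENNReal.ofReal_mul (p := (2 * n + 1) ^ d) (by positivity)]
    refine mul_le_mul' ?_ le_rfl
    have : ((2 * n + 1 : ℝ) ^ d) = (((2 * n + 1) ^ d : ℕ) : ℝ) := by push_cast; rfl
    rw [this, ENNReal.ofReal_natCast]
    have : T.card ≤ (2 * n + 1) ^ d := by simpa [mul_comm] using hT
    exact_mod_cast this

/-! ### Symmetrisation by exchanging pairs -/

/-- Exchange the entries of the `i`-th pair whenever the `i`-th coin shows `false`. -/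
def swapPairs {S : Type*} {n : ℕ} (σ : Fin n → Bool) (w : Fin n → S × S) : Fin n → S × S :=
  fun i => if σ i then w i else (w i).swap

theorem measurable_swapPairs {S : Type*} [MeasurableSpace S] {n : ℕ} :
    Measurable fun q : (Fin n → Bool) × (Fin n → S × S) => swapPairs q.1 q.2 := by
  refine measurable_pi_iff.2 fun i => Measurable.ite ?_ (by fun_prop)
    (measurable_swap.comp (by fun_prop))
  exact (measurableSet_singleton true).preimage
    (f := fun q : (Fin n → Bool) × (Fin n → S × S) => q.1 i) (by fun_prop)

theorem measurePreserving_swapPairs {S : Type*} [MeasurableSpace S] (ν : Measure S)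
    [IsProbabilityMeasure ν] {n : ℕ} (σ : Fin n → Bool) :
    MeasurePreserving (swapPairs (S := S) σ) (Measure.pi fun _ => ν.prod ν)
      (Measure.pi fun _ => ν.prod ν) := by
  refine measurePreserving_pi (f := fun i (x : S × S) => if σ i then x else x.swap) _ _ fun i => ?_
  cases σ i
  · simpa using Measure.measurePreserving_swap
  · exact MeasurePreserving.id _

/-- A measurable set of pairs of samples has small measure if, for every family of pairs, few of
the exchanges lead into it. -/
theorem measure_pi_pairs_le {S : Type*} [MeasurableSpace S] (ν : Measure S)
    [IsProbabilityMeasure ν] {n : ℕ} {G : Set (Fin n → S × S)} (hG : MeasurableSet G) {c : ℝ≥0∞}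
    (h : ∀ w, Measure.pi (fun _ : Fin n => coin) {σ | swapPairs σ w ∈ G} ≤ c) :
    Measure.pi (fun _ : Fin n => ν.prod ν) G ≤ c := by
  let τ : Measure (Fin n → Bool) := Measure.pi fun _ => coin
  let ρ : Measure (Fin n → S × S) := Measure.pi fun _ => ν.prod ν
  have hR : MeasurableSet {q : (Fin n → Bool) × (Fin n → S × S) | swapPairs q.1 q.2 ∈ G} :=
    measurable_swapPairs hG
  -- Each exchange preserves `ρ`, so `ρ G` may be averaged over the coins; Tonelli then fixes the
  -- pairs first.
  calc ρ G = ∫⁻ _, ρ G ∂τ := by simp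
    _ = ∫⁻ σ, ρ (swapPairs σ ⁻¹' G) ∂τ := by
      refine lintegral_congr fun σ => ?_
      rw [(measurePreserving_swapPairs ν σ).measure_preimage hG.nullMeasurableSet]
    _ = (τ.prod ρ) {q | swapPairs q.1 q.2 ∈ G} := (Measure.prod_apply hR).symm
    _ = ∫⁻ w, τ {σ | swapPairs σ w ∈ G} ∂ρ := Measure.prod_apply_symm hR
    _ ≤ ∫⁻ _, c ∂ρ := lintegral_mono h
    _ = c := by simp

/-- Version of `abs_integral_sub_le_of_superlevel` for sums of finitely many measures. -/
theorem abs_sum_integral_sub_le_of_superlevel {S ι : Type*} [MeasurableSpace S] [Fintype ι]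
    (μ₁ μ₂ : ι → Measure S) [∀ i, IsFiniteMeasure (μ₁ i)] [∀ i, IsFiniteMeasure (μ₂ i)]
    {f : S → ℝ≥0} (hf : Measurable f) {C : ℝ≥0} (hC : ∀ z, f z ≤ C) {g : ℝ}
    (h : ∀ b : ℝ≥0, 0 < b → b < C →
      |∑ i, (μ₁ i).real {z | b < f z} - ∑ i, (μ₂ i).real {z | b < f z}| ≤ g) :
    |∑ i, ∫ z, (f z : ℝ) ∂(μ₁ i) - ∑ i, ∫ z, (f z : ℝ) ∂(μ₂ i)| ≤ C * g := by
  have hint : ∀ (μ : ι → Measure S) [∀ i, IsFiniteMeasure (μ i)],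
      ∑ i, ∫ z, (f z : ℝ) ∂(μ i) = ∫ z, (f z : ℝ) ∂(∑ i, μ i) := fun μ _ =>
    (integral_finsetSum_measure fun i _ => Integrable.of_mem_Icc 0 C (by fun_prop)
      (ae_of_all _ fun z => ⟨by simp, by simpa using hC z⟩)).symm
  have hreal : ∀ (μ : ι → Measure S) [∀ i, IsFiniteMeasure (μ i)] (A : Set S),
      (∑ i, μ i).real A = ∑ i, (μ i).real A := fun μ _ A => by
    simp [measureReal_def, ENNReal.toReal_sum]
  rw [hint μ₁, hint μ₂]
  refine abs_integral_sub_le_of_superlevel _ _ hf hC fun b hb hbC => ?_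
  rw [hreal, hreal]
  exact h b hb hbC

theorem dirac_real_apply {S : Type*} [MeasurableSpace S] (z : S) {A : Set S}
    (hA : MeasurableSet A) : (Measure.dirac z).real A = A.indicator 1 z := by
  rw [measureReal_def, Measure.dirac_apply' _ hA]
  by_cases h : z ∈ A <;> simp [h]

theorem integral_dirac_nnreal {S : Type*} [MeasurableSpace S] (z : S) {f : S → ℝ≥0}
    (hf : Measurable f) : ∫ x, (f x : ℝ) ∂(Measure.dirac z) = f z :=
  integral_dirac' _ _ hf.coe_nnreal_real.stronglyMeasurable

theorem measurableSet_superlevel {S : Type*} [MeasurableSpace S] {f : S → ℝ≥0}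
    (hf : Measurable f) (b : ℝ≥0) : MeasurableSet {z | b < f z} :=
  measurableSet_lt measurable_const hf

/-! ### Deviation bounds for a function selected by the sample -/

section Selection

variable {S : Type*} [MeasurableSpace S] {ν : Measure S} [IsProbabilityMeasure ν]
  {n : ℕ} {f : (Fin n → S) → S → ℝ≥0} {C : ℝ≥0} {𝒜 : Set (Set S)} {d : ℕ}

/-- Exponential bound for the probability that two independent samples give far apart empirical
risks to the function selected by the first of them. -/
theorem measure_prod_abs_sum_sub_ge_le (hf : Measurable fun p : (Fin n → S) × S => f p.1 p.2)
    (hC : ∀ s z, f s z ≤ C) (h𝒜 : ∀ s (b : ℝ≥0), 0 < b → b < C → {z | b < f s z} ∈ 𝒜)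
    (hd : vcDim 𝒜 ≤ d) (hn : 0 < n) {ε η : ℝ} (hη : 0 ≤ η) (hεη : C * η < ε) :
    ((Measure.pi fun _ : Fin n => ν).prod (Measure.pi fun _ : Fin n => ν))
      {p | n * ε ≤ |∑ i, (f p.1 (p.1 i) : ℝ) - ∑ i, (f p.1 (p.2 i) : ℝ)|} ≤
      ENNReal.ofReal ((2 * n + 1) ^ d * (2 * Real.exp (-(n * (η ^ 2 / 2))))) := by
  have hfs : ∀ s, Measurable (f s) := fun s => hf.comp (by fun_prop : Measurable fun z => (s, z))
  have hm1 : ∀ i, Measurable fun p : (Fin n → S) × (Fin n → S) => f p.1 (p.1 i) := fun i =>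
    hf.comp (by fun_prop : Measurable fun p : (Fin n → S) × (Fin n → S) => (p.1, p.1 i))
  have hm2 : ∀ i, Measurable fun p : (Fin n → S) × (Fin n → S) => f p.1 (p.2 i) := fun i =>
    hf.comp (by fun_prop : Measurable fun p : (Fin n → S) × (Fin n → S) => (p.1, p.2 i))
  have hG : MeasurableSet {p : (Fin n → S) × (Fin n → S) |
      n * ε ≤ |∑ i, (f p.1 (p.1 i) : ℝ) - ∑ i, (f p.1 (p.2 i) : ℝ)|} := by
    refine measurableSet_le measurable_const ?_
    exact ((Finset.measurable_fun_sum _ fun i _ => (hm1 i).coe_nnreal_real).sub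
      (Finset.measurable_fun_sum _ fun i _ => (hm2 i).coe_nnreal_real)).abs
  have he := measurePreserving_arrowProdEquivProdArrow S S (Fin n) (fun _ => ν) (fun _ => ν)
  rw [← he.measure_preimage hG.nullMeasurableSet]
  refine measure_pi_pairs_le ν (he.measurable hG) fun w => ?_
  refine (measure_mono fun σ hσ => ?_).trans (measure_coin_exists_abs_sum_ge_le hd hn w hη)
  by_contra hcon
  simp only [Set.mem_ofPred_eq, not_exists, not_and, not_le] at hcon
  -- The selected function `f s` depends on the coins through `s`, but its superlevel sets stay in
  -- `𝒜`, so the union bound over traces of `𝒜` still covers it.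
  set v := swapPairs σ w with hv
  let s : Fin n → S := fun i => (v i).1
  have hσ' : n * ε ≤ |∑ i, (f s (v i).1 : ℝ) - ∑ i, (f s (v i).2 : ℝ)| := hσ
  have key := abs_sum_integral_sub_le_of_superlevel (fun i => Measure.dirac (v i).1)
    (fun i => Measure.dirac (v i).2) (hfs s) (hC s) (g := n * η) fun b hb hbC => by
      refine le_of_eq_of_le ?_ (hcon _ (h𝒜 s b hb hbC)).le
      rw [← Finset.sum_sub_distrib]
      congr 1
      refine Finset.sum_congr rfl fun i _ => ?_
      rw [dirac_real_apply _ (measurableSet_superlevel (hfs s) b),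
        dirac_real_apply _ (measurableSet_superlevel (hfs s) b), hv]
      -- Exchanging a pair flips the sign of its difference of indicators.
      cases h : σ i <;> simp [swapPairs, sgn, h]
  simp only [integral_dirac_nnreal _ (hfs s)] at key
  have hn' : (0 : ℝ) < n := by exact_mod_cast hn
  have := hσ'.trans key
  nlinarith

/-- Exponential bound for the deviation of the empirical mean of a bounded function from its
expectation. -/
theorem measure_pi_abs_sum_sub_ge_le {g : S → ℝ≥0} (hg : Measurable g) {C : ℝ≥0}
    (hC : ∀ z, g z ≤ C) (hn : 0 < n) {ε : ℝ} (hε : 0 ≤ ε) :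
    (Measure.pi fun _ : Fin n => ν) {t | n * ε ≤ |∑ i, (g (t i) : ℝ) - n * ∫ z, (g z : ℝ) ∂ν|} ≤
      ENNReal.ofReal (2 * Real.exp (-(n * (ε ^ 2 / (2 * (C + 1) ^ 2))))) := by
  have hint : Integrable (fun z => (g z : ℝ)) ν :=
    Integrable.of_mem_Icc 0 C (by fun_prop) (ae_of_all _ fun z => ⟨by simp, by simpa using hC z⟩)
  set m := ∫ z, (g z : ℝ) ∂ν with hm
  have hm0 : 0 ≤ m := integral_nonneg fun z => by simp
  have hmC : m ≤ C := by
    have := integral_mono hint (integrable_const (C : ℝ)) fun z => NNReal.coe_le_coe.2 (hC z)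
    simpa using this
  have := measureReal_abs_sum_ge_le (Measure.pi fun _ : Fin n => ν) hn
    (X := fun i t => (g (t i) : ℝ) - m)
    (iIndepFun_pi (X := fun _ z => (g z : ℝ) - m) fun i => by fun_prop)
    -- `C + 1` instead of `C` keeps the bound positive when `C = 0`.
    (fun i => by fun_prop) (B := C + 1) (by positivity)
    (fun i t => by
      have h1 : (g (t i) : ℝ) ≤ C := hC _
      have h2 : (0 : ℝ) ≤ g (t i) := by simp
      exact abs_le.2 ⟨by linarith, by linarith⟩)
    (fun i => by
      rw [integral_comp_eval (μ := fun _ : Fin n => ν) (f := fun z => (g z : ℝ) - m) (by fun_prop),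
        integral_sub hint (integrable_const _)]
      simp [hm]) hε
  simp only [Finset.sum_sub_distrib, Finset.sum_const, Finset.card_univ, Fintype.card_fin,
    nsmul_eq_mul] at this
  exact (ENNReal.le_ofReal_iff_toReal_le (measure_ne_top _ _) (by positivity)).2 this

/-- Exponential bound for the deviation of the empirical risk of the selected function from its
expected risk. -/
theorem measure_pi_selected_ge_le (hf : Measurable fun p : (Fin n → S) × S => f p.1 p.2)
    (hC : ∀ s z, f s z ≤ C) (h𝒜 : ∀ s (b : ℝ≥0), 0 < b → b < C → {z | b < f s z} ∈ 𝒜)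
    (hd : vcDim 𝒜 ≤ d) (hn : 0 < n) {ε η : ℝ} (hε : 0 ≤ ε) (hη : 0 ≤ η) (hεη : C * η < ε)
    (hlarge : 2 * Real.exp (-(n * (ε ^ 2 / (2 * (C + 1) ^ 2)))) ≤ 1 / 2) :
    (Measure.pi fun _ : Fin n => ν)
      {s | n * (2 * ε) ≤ |∑ i, (f s (s i) : ℝ) - n * ∫ z, (f s z : ℝ) ∂ν|} ≤
      ENNReal.ofReal (4 * ((2 * n + 1) ^ d * Real.exp (-(n * (η ^ 2 / 2))))) := by
  have hfs : ∀ s, Measurable (f s) := fun s => hf.comp (by fun_prop : Measurable fun z => (s, z))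
  let π : Measure (Fin n → S) := Measure.pi fun _ => ν
  let E : Set (Fin n → S) := {s | n * (2 * ε) ≤ |∑ i, (f s (s i) : ℝ) - n * ∫ z, (f s z : ℝ) ∂ν|}
  let G : Set ((Fin n → S) × (Fin n → S)) :=
    {p | n * ε ≤ |∑ i, (f p.1 (p.1 i) : ℝ) - ∑ i, (f p.1 (p.2 i) : ℝ)|}
  -- For a fixed bad `s`, Hoeffding puts the mean of `f s` over a fresh sample within `ε` of its
  -- expectation with probability at least 1/2; by the triangle inequality the pair then lies in
  -- `G`.
  have hE : ∀ s ∈ E, 2⁻¹ ≤ π (Prod.mk s ⁻¹' G) := by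
    intro s hs
    let D : Set (Fin n → S) := {t | n * ε ≤ |∑ i, (f s (t i) : ℝ) - n * ∫ z, (f s z : ℝ) ∂ν|}
    have hD : π D ≤ 2⁻¹ := by
      refine (measure_pi_abs_sum_sub_ge_le (hfs s) (hC s) hn hε).trans ?_
      refine (ENNReal.ofReal_le_ofReal hlarge).trans (le_of_eq ?_)
      rw [one_div, ENNReal.ofReal_inv_of_pos two_pos]; simp
    have hcover : Set.univ ⊆ D ∪ Prod.mk s ⁻¹' G := by
      intro t _
      by_contra h
      simp only [Set.mem_union, not_or] at h
      have h1 : |∑ i, (f s (t i) : ℝ) - n * ∫ z, (f s z : ℝ) ∂ν| < n * ε := not_le.1 h.1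
      have h2 : |∑ i, (f s (s i) : ℝ) - ∑ i, (f s (t i) : ℝ)| < n * ε := not_le.1 h.2
      have h3 : n * (2 * ε) ≤ |∑ i, (f s (s i) : ℝ) - n * ∫ z, (f s z : ℝ) ∂ν| := hs
      have h4 := abs_sub_le (∑ i, (f s (s i) : ℝ)) (∑ i, (f s (t i) : ℝ))
        (n * ∫ z, (f s z : ℝ) ∂ν)
      linarith
    have h1 : (1 : ℝ≥0∞) ≤ 2⁻¹ + π (Prod.mk s ⁻¹' G) :=
      calc (1 : ℝ≥0∞) = π Set.univ := by simp [π]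
        _ ≤ π (D ∪ Prod.mk s ⁻¹' G) := measure_mono hcover
        _ ≤ π D + π (Prod.mk s ⁻¹' G) := measure_union_le _ _
        _ ≤ _ := by gcongr
    rw [← ENNReal.inv_two_add_inv_two] at h1
    exact (ENNReal.add_le_add_iff_left (by simp)).1 h1
  have hprod : 2⁻¹ * π E ≤ (π.prod π) G := by
    -- A measurable hull of `G` suffices for Tonelli, and `E` need not be measurable.
    let G' := toMeasurable (π.prod π) G
    calc 2⁻¹ * π E = ∫⁻ _ in E, 2⁻¹ ∂π := by simp
      _ ≤ ∫⁻ s in E, π (Prod.mk s ⁻¹' G') ∂π :=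
        setLIntegral_mono (measurable_measure_prodMk_left (measurableSet_toMeasurable _ _))
          fun s hs => (hE s hs).trans (measure_mono (Set.preimage_mono (subset_toMeasurable _ _)))
      _ ≤ ∫⁻ s, π (Prod.mk s ⁻¹' G') ∂π := setLIntegral_le_lintegral _ _
      _ = (π.prod π) G := by
        rw [← Measure.prod_apply (measurableSet_toMeasurable _ _), measure_toMeasurable]
  have h2 : π E ≤ 2 * (π.prod π) G := by
    calc π E = 2 * (2⁻¹ * π E) := by
          rw [← mul_assoc, ENNReal.mul_inv_cancel two_ne_zero ENNReal.ofNat_ne_top, one_mul]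
      _ ≤ _ := by gcongr
  refine h2.trans ((mul_le_mul' le_rfl
    (measure_prod_abs_sum_sub_ge_le hf hC h𝒜 hd hn hη hεη)).trans (le_of_eq ?_))
  rw [show (2 : ℝ≥0∞) = ENNReal.ofReal 2 by simp, ← ENNReal.ofReal_mul two_pos.le]
  congr 1
  ring

end Selection

/-! ### Borel–Cantelli and the almost sure limit -/

theorem summable_two_mul_add_one_pow_mul_exp (d : ℕ) {c : ℝ} (hc : 0 < c) :
    Summable fun n : ℕ => (2 * n + 1 : ℝ) ^ d * Real.exp (-(n * c)) := by
  have h := ((summable_nat_add_iff 1).2 (Real.summable_pow_mul_exp_neg_nat_mul d hc)).mul_left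
    (2 ^ d * Real.exp c)
  refine Summable.of_nonneg_of_le (fun n => by positivity) (fun n => ?_) h
  have h1 : (2 * n + 1 : ℝ) ^ d ≤ 2 ^ d * (n + 1) ^ d := by
    rw [← mul_pow]
    gcongr
    linarith
  have h2 : Real.exp (-(n * c)) = Real.exp c * Real.exp (-c * (n + 1 : ℕ)) := by
    rw [← Real.exp_add]
    congr 1
    push_cast
    ring
  calc _ ≤ 2 ^ d * (n + 1 : ℝ) ^ d * Real.exp (-(n * c)) := by gcongr
    _ = _ := by rw [h2]; push_cast; ring

/-- The law of large numbers for a function selected by the sample from a bounded class whose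
superlevel sets have finite VC dimension. -/
theorem ae_tendsto_selected {S Ω : Type*} [MeasurableSpace S] [MeasurableSpace Ω]
    (P : Measure Ω) [IsProbabilityMeasure P] (ν : Measure S) [IsProbabilityMeasure ν]
    (Z : ℕ → Ω → S) (hZmeas : ∀ i, Measurable (Z i)) (hZindep : iIndepFun Z P)
    (hZlaw : ∀ i, P.map (Z i) = ν) {f : (n : ℕ) → (Fin n → S) → S → ℝ≥0}
    (hf : ∀ n, Measurable fun p : (Fin n → S) × S => f n p.1 p.2) {C : ℝ≥0}
    (hC : ∀ n s z, f n s z ≤ C) {𝒜 : Set (Set S)}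
    (h𝒜 : ∀ n s (b : ℝ≥0), 0 < b → b < C → {z | b < f n s z} ∈ 𝒜) (hVC : vcDim 𝒜 < ⊤) :
    ∀ᵐ ω ∂P, Tendsto (fun n : ℕ => (1 / (n : ℝ)) * ∑ i : Fin n, (f n (fun i => Z i ω) (Z i ω) : ℝ)
      - ∫ z, (f n (fun i : Fin n => Z i ω) z : ℝ) ∂ν) atTop (𝓝 0) := by
  obtain ⟨d, hd⟩ := ENat.ne_top_iff_exists.1 hVC.ne
  have hlaw : ∀ n, P.map (fun ω (i : Fin n) => Z i ω) = Measure.pi fun _ : Fin n => ν := fun n => by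
    have := (iIndepFun_iff_map_fun_eq_pi_map (f := fun i : Fin n => Z i)
      fun i => (hZmeas i).aemeasurable).1 (hZindep.precomp Fin.val_injective)
    simpa only [hZlaw] using this
  have hev : ∀ k : ℕ, ∀ᵐ ω ∂P, ∀ᶠ n : ℕ in atTop, |∑ i : Fin n, (f n (fun i => Z i ω) (Z i ω) : ℝ)
      - n * ∫ z, (f n (fun i : Fin n => Z i ω) z : ℝ) ∂ν| < n * (2 * (1 / (k + 1 : ℝ))) := by
    intro k
    set ε : ℝ := 1 / (k + 1 : ℝ) with hε
    have hεpos : 0 < ε := by positivity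
    -- Chosen so that `C * η < ε`, including when `C = 0`.
    set η : ℝ := ε / (C + 1) with hη
    have hηpos : 0 < η := by positivity
    have hεη : C * η < ε := by
      have : (C + 1) * η = ε := by rw [hη]; field_simp
      linarith
    have hlarge : ∀ᶠ n : ℕ in atTop,
        2 * Real.exp (-(n * (ε ^ 2 / (2 * (C + 1 : ℝ) ^ 2)))) ≤ 1 / 2 := by
      have h1 : Tendsto (fun n : ℕ => 2 * Real.exp (-(n * (ε ^ 2 / (2 * (C + 1 : ℝ) ^ 2)))))
          atTop (𝓝 (2 * 0)) :=
        ((Real.tendsto_exp_neg_atTop_nhds_zero.comp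
          (tendsto_natCast_atTop_atTop.atTop_mul_const (by positivity)))).const_mul 2
      exact (h1.eventually_lt_const (by norm_num)).mono fun n hn => hn.le
    obtain ⟨N, hN⟩ := eventually_atTop.1 (hlarge.and (eventually_gt_atTop 0))
    -- The deviation bound is available only from `N` on; emptying the earlier events does not
    -- affect what happens eventually.
    let E (n : ℕ) : Set Ω := if N ≤ n then {ω | n * (2 * ε) ≤
      |∑ i : Fin n, (f n (fun i => Z i ω) (Z i ω) : ℝ)
        - n * ∫ z, (f n (fun i : Fin n => Z i ω) z : ℝ) ∂ν|} else ∅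
    have hsum := (summable_two_mul_add_one_pow_mul_exp d (half_pos (pow_pos hηpos 2))).mul_left 4
    have hE : ∀ n, P (E n) ≤
        ENNReal.ofReal (4 * ((2 * n + 1) ^ d * Real.exp (-(n * (η ^ 2 / 2))))) := by
      intro n
      by_cases hn : N ≤ n
      · have hb := measure_pi_selected_ge_le (ν := ν) (hf n) (hC n) (h𝒜 n) hd.ge (hN n hn).2
          hεpos.le hηpos.le hεη (hN n hn).1
        rw [← hlaw n] at hb
        simp only [E, if_pos hn]
        have hsm : Measurable fun ω (i : Fin n) => Z i ω :=
          measurable_pi_lambda _ fun i => hZmeas i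
        exact (Measure.le_map_apply hsm.aemeasurable _).trans hb
      · simp [E, hn]
    have hBC := ae_eventually_notMem (μ := P) (s := E)
      (ne_top_of_le_ne_top hsum.tsum_ofReal_ne_top (ENNReal.tsum_le_tsum hE))
    filter_upwards [hBC] with ω hω
    filter_upwards [hω, eventually_ge_atTop N] with n hn hNn
    simpa [E, hNn] using hn
  -- Countably many tolerances `1 / (k + 1)`, hence a single null set.
  filter_upwards [ae_all_iff.2 hev] with ω hω
  refine Metric.tendsto_nhds.2 fun r hr => ?_
  obtain ⟨k, hk⟩ := exists_nat_one_div_lt (half_pos hr)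
  filter_upwards [hω k, eventually_gt_atTop 0] with n hn hn0
  have hn' : (0 : ℝ) < n := by exact_mod_cast hn0
  rw [dist_zero_right, Real.norm_eq_abs]
  refine lt_of_mul_lt_mul_left (a := (n : ℝ)) ?_ hn'.le
  rw [← abs_of_pos hn', ← abs_mul, abs_of_pos hn', mul_sub, ← mul_assoc, mul_one_div_cancel hn'.ne',
    one_mul]
  refine hn.trans ?_
  have := mul_lt_mul_of_pos_left hk hn'
  linarith

/-! ### From the gap to the resubstitution error -/

section Loss

variable {X Y : Type*} {ℓ : Y → Y → ℝ≥0} {H : Set (X → Y)}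

theorem lossAt_le (hbdd : lossSup ℓ H < ⊤) (ψ : H) (z : X × Y) :
    lossAt ℓ ψ z ≤ (lossSup ℓ H).toNNReal := by
  rw [← ENNReal.coe_le_coe, ENNReal.coe_toNNReal hbdd.ne]
  exact le_iSup₂_of_le z ψ le_rfl

theorem superlevel_mem (hbdd : lossSup ℓ H < ⊤) (ψ : H) {b : ℝ≥0} (hb : 0 < b)
    (hbC : b < (lossSup ℓ H).toNNReal) : {z | b < lossAt ℓ ψ z} ∈ superlevelSets ℓ H :=
  ⟨ψ, ψ.2, b, hb, by rw [← ENNReal.coe_toNNReal hbdd.ne]; exact_mod_cast hbC, rfl⟩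

variable [MeasurableSpace (X × Y)]

/-- An average of `n` differences is at most their supremum; for `n = 0` the factor `1 / n` is zero.
-/
theorem empiricalGap_le_uniformGap (Ψ : PredictionRule H) (β : Smoothing H) {n : ℕ}
    (s : Fin n → X × Y) : empiricalGap ℓ Ψ β s ≤ uniformGap ℓ β s := by
  refine iSup₂_mono fun A _ => ?_
  rw [← mul_sub, ← Finset.sum_sub_distrib, abs_mul,
    abs_of_nonneg (by positivity : (0 : ℝ) ≤ 1 / n), ENNReal.ofReal_mul (by positivity)]
  set c : Fin n → ℝ := fun i => (β n s (s i) (Ψ n s)).real A - (Measure.dirac (s i)).real A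
  set M : ℝ≥0∞ := ⨆ (z : X × Y) (ψ : H),
    ENNReal.ofReal |(β n s z ψ).real A - (Measure.dirac z).real A|
  have hc : ENNReal.ofReal |∑ i, c i| ≤ n * M := by
    calc _ ≤ ENNReal.ofReal (∑ i, |c i|) :=
          ENNReal.ofReal_le_ofReal (Finset.abs_sum_le_sum_abs _ _)
      _ = ∑ i, ENNReal.ofReal |c i| := ENNReal.ofReal_sum_of_nonneg fun i _ => abs_nonneg _
      _ ≤ ∑ _i : Fin n, M := Finset.sum_le_sum fun i _ => le_iSup₂_of_le (s i) (Ψ n s) le_rfl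
      _ = n * M := by simp
  rcases Nat.eq_zero_or_pos n with rfl | hn
  · simp
  · calc _ ≤ ENNReal.ofReal (1 / n) * (n * M) := by gcongr
      _ = M := by
        rw [one_div, ENNReal.ofReal_inv_of_pos (by exact_mod_cast hn), ENNReal.ofReal_natCast,
          ← mul_assoc, ENNReal.inv_mul_cancel (by exact_mod_cast hn.ne') (by simp), one_mul]

/-- The smoothed and the plain resubstitution errors differ by at most `C_ℓ` times the gap. -/
theorem abs_genResubError_sub_le (hmeas : ∀ ψ ∈ H, Measurable (lossAt ℓ ψ))
    (hbdd : lossSup ℓ H < ⊤) (Ψ : PredictionRule H) (β : Smoothing H)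
    (hβ : ∀ n s z ψ, IsProbabilityMeasure (β n s z ψ)) {n : ℕ} (hn : 0 < n) (s : Fin n → X × Y)
    (hgap : empiricalGap ℓ Ψ β s ≠ ⊤) :
    |genResubError ℓ Ψ β s - (1 / (n : ℝ)) * ∑ i, (lossAt ℓ (Ψ n s) (s i) : ℝ)| ≤
      (lossSup ℓ H).toNNReal * (empiricalGap ℓ Ψ β s).toReal := by
  have hn' : (0 : ℝ) < n := by exact_mod_cast hn
  have hψ := hmeas (Ψ n s) (Ψ n s).2
  have key := abs_sum_integral_sub_le_of_superlevel (fun i => β n s (s i) (Ψ n s))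
    (fun i => Measure.dirac (s i)) hψ (lossAt_le hbdd (Ψ n s))
    (g := n * (empiricalGap ℓ Ψ β s).toReal) fun b hb hbC => by
      have h1 : ENNReal.ofReal _ ≤ empiricalGap ℓ Ψ β s :=
        le_iSup₂_of_le _ (superlevel_mem hbdd (Ψ n s) hb hbC) le_rfl
      have h2 := (ENNReal.ofReal_le_iff_le_toReal hgap).1 h1
      rw [← mul_sub, abs_mul, abs_of_pos (by positivity : (0 : ℝ) < 1 / n), one_div,
        inv_mul_le_iff₀ hn'] at h2
      exact h2
  simp only [integral_dirac_nnreal _ hψ] at key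
  rw [genResubError, ← mul_sub, abs_mul, abs_of_pos (by positivity : (0 : ℝ) < 1 / n), one_div,
    inv_mul_le_iff₀ hn']
  exact key.trans (le_of_eq (by ring))

end Loss

end GenResub

theorem corollary3 {X Y Ω : Type*} [MeasurableSpace (X × Y)] [MeasurableSpace Ω]
    -- the i.i.d. data with law `ν`
    (P : Measure Ω) [IsProbabilityMeasure P] (ν : Measure (X × Y)) [IsProbabilityMeasure ν]
    (Z : ℕ → Ω → X × Y) (hZmeas : ∀ i, Measurable (Z i)) (hZindep : iIndepFun Z P)
    (hZlaw : ∀ i, P.map (Z i) = ν)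
    -- the loss and the hypothesis space
    (ℓ : Y → Y → ℝ≥0) (H : Set (X → Y))
    (hmeas : ∀ ψ ∈ H, Measurable (GenResub.lossAt ℓ ψ))
    (hbdd : GenResub.lossSup ℓ H < ⊤)
    (hVC : GenResub.lossVCDim ℓ H < ⊤)
    -- the prediction rule, measurable in the sample and the point jointly
    (Ψ : GenResub.PredictionRule H)
    (hΨ : ∀ n, Measurable
      (fun p : (Fin n → X × Y) × (X × Y) => GenResub.lossAt ℓ (Ψ n p.1) p.2))
    -- the smoothing measures
    (β : GenResub.Smoothing H) (hβ : ∀ n s z ψ, IsProbabilityMeasure (β n s z ψ)) :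
    ((∀ᵐ ω ∂P, Tendsto (fun n => GenResub.empiricalGap ℓ Ψ β (GenResub.sample Z n ω))
        atTop (𝓝 0)) →
      GenResub.IsConsistent P Z ν ℓ Ψ β) ∧
    ((∀ᵐ ω ∂P, Tendsto (fun n => GenResub.uniformGap ℓ β (GenResub.sample Z n ω))
        atTop (𝓝 0)) →
      GenResub.IsConsistent P Z ν ℓ Ψ β) := by
  open GenResub in
  have hfirst : (∀ᵐ ω ∂P, Tendsto (fun n => empiricalGap ℓ Ψ β (sample Z n ω)) atTop (𝓝 0)) →
      IsConsistent P Z ν ℓ Ψ β := by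
    intro hgap
    have hLLN := ae_tendsto_selected P ν Z hZmeas hZindep hZlaw
      (f := fun n s z => lossAt ℓ (Ψ n s) z) hΨ (fun n s => lossAt_le hbdd (Ψ n s))
      (fun n s _ hb hbC => superlevel_mem hbdd (Ψ n s) hb hbC) hVC
    filter_upwards [hgap, hLLN] with ω hω hlln
    have hdiff : Tendsto (fun n : ℕ => genResubError ℓ Ψ β (sample Z n ω)
        - (1 / (n : ℝ)) * ∑ i, (lossAt ℓ (Ψ n (sample Z n ω)) (sample Z n ω i) : ℝ))
        atTop (𝓝 0) := by
      have h0 : Tendsto (fun n : ℕ => ((lossSup ℓ H).toNNReal : ℝ) *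
          (empiricalGap ℓ Ψ β (sample Z n ω)).toReal) atTop (𝓝 0) := by
        simpa using ((ENNReal.tendsto_toReal ENNReal.zero_ne_top).comp hω).const_mul
          ((lossSup ℓ H).toNNReal : ℝ)
      refine squeeze_zero_norm' ?_ h0
      -- A gap tending to zero is eventually finite; this matters because `toReal` sends `⊤` to 0.
      filter_upwards [eventually_gt_atTop 0, hω.eventually_ne ENNReal.zero_ne_top] with n hn hn'
      exact abs_genResubError_sub_le hmeas hbdd Ψ β hβ hn _ hn'
    have := (hdiff.add hlln).abs
    simp only [add_zero, abs_zero] at this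
    refine this.congr fun n => ?_
    congr 1
    exact sub_add_sub_cancel _ _ _
  refine ⟨hfirst, fun hgap => hfirst ?_⟩
  filter_upwards [hgap] with ω hω
  exact tendsto_of_tendsto_of_tendsto_of_le_of_le tendsto_const_nhds hω (fun _ => zero_le)
    fun n => GenResub.empiricalGap_le_uniformGap Ψ β _
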